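/- **Discrete-bidding games.** Let $V$ be a finite set of vertices, $E\subseteq V\times V$ a set of edges such that every vertex has at least one neighbor, $w:E\to\mathbb Z$ a weight function, and $k\in\mathbb N$. Let $\mathbb N^*=\{0,0^*,1,1^*,2,2^*,\dots\}$, ordered by $0<0^*<1<1^*<\cdots$; a star on a budget marks the player who holds the tie-breaking advantage, and a star on a bid marks that the bidder uses the advantage in case of a tie. Let $[k]=\{0,0^*,\dots,k,k^*\}$. For $x,y\in\mathbb N$ let $x\oplus y=x+y$, $x^*\oplus y=x\oplus y^*=(x+y)^*$, $x^*\oplus y^*=x+y+1$, and $x\ominus y=x^*\ominus y^*=x-y$, $x^*\ominus y=(x-y)^*$, $x\ominus y^*=(x-y-1)^*$. A configuration is a pair $\langle v,B\rangle$ with $v\in V$, $B\in[k]$: the token is on $v$, Player 1 has budget $B$ and Player 2 has budget $k^*\ominus B$ (so exactly one of them holds the advantage). In each turn the players simultaneously choose actions $\langle b_1,u_1\rangle$, $\langle b_2,u_2\rangle$, where $u_i$ is a neighbor of $v$, and $b_i\in\mathbb N^*$ is at most the budget of Player $i$ and may carry a star only if Player $i$ holds the advantage. Player 1 wins the bidding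 if $b_1>b_2$, Player 2 wins it if $b_2>b_1$, and if $b_1=b_2$, the player who does not hold the advantage wins it. The next configuration is $\langle u_1,B\ominus b_1\rangle$ if Player 1 wins the bidding and $\langle u_2,B\oplus b_2\rangle$ if Player 2 wins it. A (pure) strategy maps each finite history of configurations to an allowed action. Two strategies and an initial configuration determine an infinite path $\pi=v_0,v_1,\dots$ in $(V,E)$; write $S_m(\pi)=\sum_{0\le j<m}w(v_j,v_{j+1})$. **Energy objective.** Player 1 is called Pres and Player 2 Cons. For an integer $M$, Pres *$M$-wins* from $\langle v,B\rangle$ if she has a strategy such that against every strategy of Cons, $M+S_m(\pi)\ge 0$ for all $m\in\mathbb N$; Cons *$M$-wins* from $\langle v,B\rangle$ if he has a strategy such that against every strategy of Pres, $M+S_m(\pi)<0$ for some $m\in\mathbb N$. A function $\mathrm{energy}:V\times[k]\to\mathbb N\cup\{\infty\}$ is an *energy threshold* function if for every $\langle v,B\rangle$: when $\mathrm{energy}(v,B)=M\in\mathbb N$, Pres $M$-wins and Cons $(M-1)$-wins from $\langle v,B\rangle$; when $\mathrm{energy}(v,B)=\infty$, Cons $M$-wins from $\langle v,B\rangle$ for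 every $M\in\mathbb N$. **Mean-payoff objective.** Player 1 is called Max and Player 2 Min. The payoff of $\pi$ is $\mathrm{MP}(\pi)=\liminf_{m\to\infty}\frac1m S_m(\pi)$. Max can guarantee a non-negative mean payoff from $\langle v,B\rangle$ if he has a strategy such that $\mathrm{MP}(\pi)\ge0$ against every strategy of Min; Min can guarantee a negative mean payoff if she has a strategy such that $\mathrm{MP}(\pi)<0$ against every strategy of Max. **Theorem.** Such a game has exactly one energy threshold function $\mathrm{energy}$. For every $v\in V$ and $B\in[k]$: $\mathrm{energy}(v,B)<\infty$ if and only if Max can guarantee a non-negative mean payoff from $\langle v,B\rangle$, and $\mathrm{energy}(v,B)=\infty$ if and only if Min can guarantee a negative mean payoff from $\langle v,B\rangle$. Moreover, let $\mathrm{Th}(v)=\min\{B\in[k]:\mathrm{energy}(v,B)<\infty\}$, and $\mathrm{Th}(v)=k+1$ if this set is empty. Then for every $v\in V$ and $B\in[k]$, Max can guarantee a non-negative mean payoff from $\langle v,B\rangle$ if and only if $B\ge\mathrm{Th}(v)$, and Min can guarantee a negative mean payoff from $\langle v,B\rangle$ if and only if $B<\mathrm{Th}(v)$. -/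

import Mathlib

/-- The set `ℕ* = {0, 0*, 1, 1*, …}`. `⟨x, false⟩` is the number `x` and `⟨x, true⟩` is `x*`:
as a budget, `x` together with the tie-breaking advantage; as a bid, `x` together with the
announcement that the advantage is used if a tie occurs. -/
@[ext] structure StarNat where
  /-- the integral part -/
  amount : ℕ
  /-- whether the number carries a `*` -/
  adv : Bool

namespace StarNat

/-- The position of an element in the list `0, 0*, 1, 1*, 2, 2*, …`. -/
def pos (x : StarNat) : ℕ := 2 * x.amount + x.adv.toNat

theorem pos_injective : Function.Injective pos := by
  rintro ⟨x, a⟩ ⟨y, b⟩ h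
  cases a <;> cases b <;> simp [pos] at h ⊢ <;> omega

/-- The natural order `0 < 0* < 1 < 1* < …`. -/
instance : LinearOrder StarNat := LinearOrder.lift' pos pos_injective

theorem lt_iff_pos (x y : StarNat) : x < y ↔ x.pos < y.pos := Iff.rfl

instance : WellFoundedLT StarNat :=
  ⟨(InvImage.wf pos Nat.lt_wfRel.wf : WellFounded fun x y : StarNat => x.pos < y.pos)⟩

/-- `x* ⊕ y = x ⊕ y* = (x + y)*`, `x ⊕ y = x + y`, `x* ⊕ y* = x + y + 1`. -/
def oplus : StarNat → StarNat → StarNat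
  | ⟨x, true⟩, ⟨y, false⟩ => ⟨x + y, true⟩
  | ⟨x, false⟩, ⟨y, true⟩ => ⟨x + y, true⟩
  | ⟨x, false⟩, ⟨y, false⟩ => ⟨x + y, false⟩
  | ⟨x, true⟩, ⟨y, true⟩ => ⟨x + y + 1, false⟩

/-- `x* ⊖ y = (x - y)*`, `x* ⊖ y* = x - y`, `x ⊖ y = x - y`, `x ⊖ y* = (x - y - 1)*`.
It is only ever applied to a budget and a bid within that budget, or to the total budget `k*` and
a part of it, so that the truncation of the subtraction of `ℕ` plays no role. -/
def ominus : StarNat → StarNat → StarNat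
  | ⟨x, true⟩, ⟨y, false⟩ => ⟨x - y, true⟩
  | ⟨x, true⟩, ⟨y, true⟩ => ⟨x - y, false⟩
  | ⟨x, false⟩, ⟨y, false⟩ => ⟨x - y, false⟩
  | ⟨x, false⟩, ⟨y, true⟩ => ⟨x - y - 1, true⟩

/-- With budget `B` one may bid `b` if `b` is at most `B`, and a bid that uses the advantage
requires that the bidder holds the advantage. -/
def LegalBid (B b : StarNat) : Prop := b ≤ B ∧ (b.adv = true → B.adv = true)

end StarNat

/-- A weighted arena `⟨V, E, k, w⟩` of a discrete-bidding game. Every vertex has a neighbor, so that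
the players always have an allowed action. The value of `weight` matters on edges only. -/
structure BiddingGame (V : Type*) where
  /-- the total budget is `k*` -/
  k : ℕ
  /-- the edge relation -/
  Edge : V → V → Prop
  exists_edge : ∀ v, ∃ u, Edge v u
  /-- integer edge weights -/
  weight : V → V → ℤ

namespace BiddingGame

variable {V : Type*} (G : BiddingGame V)

/-- The total budget `k*`. -/
def total : StarNat := ⟨G.k, true⟩

/-- The budgets `[k] = {0, 0*, …, k, k*}`. -/
abbrev Budget : Type := {B : StarNat // B ≤ G.total}

/-- A configuration `⟨v, B⟩`: the token is on `v` and the budget of Player 1 is `B`.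
The budget of Player 2 is `k* ⊖ B`. -/
abbrev Config (_ : BiddingGame V) : Type _ := V × StarNat

/-- An action `⟨b, u⟩`: bid `b`, and move the token to `u` upon winning the bidding. -/
abbrev Action (_ : BiddingGame V) : Type _ := StarNat × V

/-- Player 1 wins the bidding at a configuration in which his budget is `B` if his bid is higher,
or if there is a tie and Player 2 holds the advantage (and, having bid the same element of `ℕ*`,
does not use it). -/
def WinsBid (B b₁ b₂ : StarNat) : Prop := b₂ < b₁ ∨ (b₁ = b₂ ∧ B.adv = false)

open Classical in
/-- The transition function. -/
noncomputable def step (c : G.Config) (a₁ a₂ : G.Action) : G.Config :=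
  if WinsBid c.2 a₁.1 a₂.1 then (a₁.2, c.2.ominus a₁.1) else (a₂.2, c.2.oplus a₂.1)

/-- A (pure, history-dependent) strategy. Its arguments are the list of the past configurations
and the current configuration. -/
abbrev Strategy : Type _ := List G.Config → G.Config → G.Action

/-- A strategy of Player 1 chooses only allowed actions. -/
def Legal₁ (σ : G.Strategy) : Prop :=
  ∀ h v B, B ≤ G.total → StarNat.LegalBid B (σ h (v, B)).1 ∧ G.Edge v (σ h (v, B)).2

/-- A strategy of Player 2 chooses only allowed actions. -/
def Legal₂ (τ : G.Strategy) : Prop :=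
  ∀ h v B, B ≤ G.total →
    StarNat.LegalBid (G.total.ominus B) (τ h (v, B)).1 ∧ G.Edge v (τ h (v, B)).2

/-- The past configurations and the current configuration after `n` turns. -/
noncomputable def run (c₀ : G.Config) (σ τ : G.Strategy) : ℕ → List G.Config × G.Config
  | 0 => ([], c₀)
  | n + 1 =>
    let h := (run c₀ σ τ n).1
    let c := (run c₀ σ τ n).2
    (h ++ [c], G.step c (σ h c) (τ h c))

/-- The infinite path in `⟨V, E⟩` that two strategies give rise to. -/
noncomputable def path (c₀ : G.Config) (σ τ : G.Strategy) (n : ℕ) : V := (G.run c₀ σ τ n).2.1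

/-- The energy of the prefix of length `m` of a path: the sum of the weights traversed. -/
def sumWeights (π : ℕ → V) (m : ℕ) : ℤ := ∑ j ∈ Finset.range m, G.weight (π j) (π (j + 1))

/-- Player 1 can enforce that the path has the property `P`. -/
def Enforces₁ (c₀ : G.Config) (P : (ℕ → V) → Prop) : Prop :=
  ∃ σ, G.Legal₁ σ ∧ ∀ τ, G.Legal₂ τ → P (G.path c₀ σ τ)

/-- Player 2 can enforce that the path has the property `P`. -/
def Enforces₂ (c₀ : G.Config) (P : (ℕ → V) → Prop) : Prop :=
  ∃ τ, G.Legal₂ τ ∧ ∀ σ, G.Legal₁ σ → P (G.path c₀ σ τ)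

/-- Preserver (Player 1) `M`-wins from `⟨v, B⟩`. -/
def PresWins (M : ℤ) (v : V) (B : G.Budget) : Prop :=
  G.Enforces₁ (v, B.1) fun π => ∀ m, 0 ≤ M + G.sumWeights π m

/-- Consumer (Player 2) `M`-wins from `⟨v, B⟩`. -/
def ConsWins (M : ℤ) (v : V) (B : G.Budget) : Prop :=
  G.Enforces₂ (v, B.1) fun π => ∃ m, M + G.sumWeights π m < 0

/-- `energy` is an energy threshold function of the game: if `energy(v, B) = M < ∞`, then
Preserver `M`-wins and Consumer `(M-1)`-wins from `⟨v, B⟩`; if `energy(v, B) = ∞`, then Consumer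
`M`-wins from `⟨v, B⟩` for every `M`. -/
def IsEnergyThreshold (energy : V → G.Budget → ℕ∞) : Prop :=
  ∀ v B,
    (∀ M : ℕ, energy v B = M → G.PresWins M v B ∧ G.ConsWins ((M : ℤ) - 1) v B) ∧
    (energy v B = ⊤ → ∀ M : ℕ, G.ConsWins M v B)

/-- The mean payoff of an infinite path. -/
noncomputable def meanPayoff (π : ℕ → V) : ℝ :=
  Filter.liminf (fun m : ℕ => (1 / (m : ℝ)) * (G.sumWeights π m : ℝ)) Filter.atTop

/-- Maximizer (Player 1) can guarantee a non-negative mean payoff from `⟨v, B⟩`. -/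
def MaxWins (v : V) (B : G.Budget) : Prop :=
  G.Enforces₁ (v, B.1) fun π => 0 ≤ G.meanPayoff π

/-- Minimizer (Player 2) can guarantee a negative mean payoff from `⟨v, B⟩`. -/
def MinWins (v : V) (B : G.Budget) : Prop :=
  G.Enforces₂ (v, B.1) fun π => G.meanPayoff π < 0

open Classical in
/-- The threshold budget derived from `energy` at `v`: the least `B` in `[k]` with
`energy(v, B) < ∞`, and `k + 1` if there is none. -/
noncomputable def thresholdBudget (energy : V → G.Budget → ℕ∞) (v : V) : StarNat :=
  if h : {B : G.Budget | energy v B < ⊤}.Nonempty then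
    (WellFounded.min (wellFounded_lt (α := G.Budget)) _ h).1
  else ⟨G.k + 1, false⟩

end BiddingGame

/-! The key is determinacy in pure strategies although bids are simultaneous. In a single turn with
a target set of configurations, take each player's greatest bid that leads to a favourable
configuration when it wins; the player whose greatest bid prevails forces the outcome
(`forces_or_forces`). Hence the games with finite horizon, `Survives n`, are determined. As only
finitely many actions are available, compactness passes to `SurvivesAlways`: Preserver can maintain
this condition forever, and where it fails Consumer exhausts the energy within a fixed number of
turns. The energy threshold is the least `M` for which it holds.

A finite threshold bounds the partial sums below, so the mean payoff is non-negative. Where no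
energy suffices, finiteness of the set of configurations gives uniform bounds: Minimizer plays
rounds of at most `N` turns, each lowering the energy by at least one and ending where again no
energy suffices, so the mean payoff is at most `-1/N`. Opposite objectives exclude each other, which
turns these implications into equivalences.

The threshold budget needs monotonicity in the budget (`Forces₁.mono_budget`). It is delicate
because one position more in `ℕ*` also passes the advantage from one player to the other. -/

namespace StarNat

/-! ### Positions: `⊕` and `⊖` as arithmetic in `ℕ`, with the advantage as parity -/

theorem le_iff_pos (x y : StarNat) : x ≤ y ↔ x.pos ≤ y.pos := Iff.rfl

theorem adv_iff_pos (x : StarNat) : x.adv = true ↔ x.pos % 2 = 1 := by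
  obtain ⟨x, a⟩ := x
  cases a <;> simp [pos]

theorem adv_eq_false_iff_pos (x : StarNat) : x.adv = false ↔ x.pos % 2 = 0 := by
  obtain ⟨x, a⟩ := x
  cases a <;> simp [pos]

/-- The element of `ℕ*` at a given position. -/
def ofPos (n : ℕ) : StarNat := ⟨n / 2, decide (n % 2 = 1)⟩

@[simp] theorem pos_ofPos (n : ℕ) : (ofPos n).pos = n := by
  rcases Nat.mod_two_eq_zero_or_one n with h | h <;> simp [ofPos, pos, h] <;> omega

theorem pos_oplus (x y : StarNat) : (x.oplus y).pos = x.pos + y.pos := by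
  obtain ⟨x, a⟩ := x
  obtain ⟨y, b⟩ := y
  cases a <;> cases b <;> simp [pos, oplus] <;> omega

theorem pos_ominus {x y : StarNat} (h : y ≤ x) : (x.ominus y).pos = x.pos - y.pos := by
  obtain ⟨x, a⟩ := x
  obtain ⟨y, b⟩ := y
  rw [le_iff_pos] at h
  cases a <;> cases b <;> simp [pos, ominus] at h ⊢ <;> omega

theorem legalBid_iff_pos (B b : StarNat) :
    LegalBid B b ↔ b.pos ≤ B.pos ∧ (b.pos % 2 = 1 → B.pos % 2 = 1) := by
  rw [LegalBid, le_iff_pos, adv_iff_pos, adv_iff_pos]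

theorem legalBid_zero (B : StarNat) : LegalBid B (ofPos 0) := by
  simp [legalBid_iff_pos]

theorem oplus_zero (B : StarNat) : B.oplus (ofPos 0) = B :=
  pos_injective (by simp [pos_oplus])

theorem ominus_zero (B : StarNat) : B.ominus (ofPos 0) = B :=
  pos_injective (by rw [pos_ominus] <;> simp [le_iff_pos])

theorem finite_Iic (T : StarNat) : (Set.Iic T).Finite :=
  Set.Finite.of_finite_image ((Set.finite_Iic T.pos).subset (by rintro _ ⟨x, hx, rfl⟩; exact hx))
    pos_injective.injOn

/-- A nonempty set of bids within a budget has a greatest element. -/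
theorem exists_greatest {P : StarNat → Prop} (T : StarNat) (hP : ∀ b, P b → b ≤ T)
    (hne : ∃ b, P b) : ∃ b, P b ∧ ∀ b', P b' → b' ≤ b := by
  have hfin : {b | P b}.Finite := (finite_Iic T).subset hP
  obtain ⟨b, hb, hmax⟩ := Set.exists_max_image {b | P b} id hfin hne
  exact ⟨b, hb, hmax⟩

end StarNat

namespace BiddingGame

open StarNat Filter

variable {V : Type*} (G : BiddingGame V)

/-! ### A single turn: determinacy and monotonicity in the budget -/

/-- The actions allowed to Player 1. -/
def LegalAction₁ (c : G.Config) (a : G.Action) : Prop :=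
  LegalBid c.2 a.1 ∧ G.Edge c.1 a.2

/-- The actions allowed to Player 2. -/
def LegalAction₂ (c : G.Config) (a : G.Action) : Prop :=
  LegalBid (G.total.ominus c.2) a.1 ∧ G.Edge c.1 a.2

theorem exists_legalAction₁ (c : G.Config) : ∃ a, G.LegalAction₁ c a :=
  let ⟨u, hu⟩ := G.exists_edge c.1
  ⟨(ofPos 0, u), legalBid_zero _, hu⟩

theorem exists_legalAction₂ (c : G.Config) : ∃ a, G.LegalAction₂ c a :=
  let ⟨u, hu⟩ := G.exists_edge c.1
  ⟨(ofPos 0, u), legalBid_zero _, hu⟩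

theorem pos_total : G.total.pos = 2 * G.k + 1 := rfl

theorem step_of_wins {c : G.Config} {a₁ a₂ : G.Action} (h : WinsBid c.2 a₁.1 a₂.1) :
    G.step c a₁ a₂ = (a₁.2, c.2.ominus a₁.1) := if_pos h

theorem step_of_not_wins {c : G.Config} {a₁ a₂ : G.Action} (h : ¬ WinsBid c.2 a₁.1 a₂.1) :
    G.step c a₁ a₂ = (a₂.2, c.2.oplus a₂.1) := if_neg h

theorem winsBid_iff_pos (B b₁ b₂ : StarNat) :
    WinsBid B b₁ b₂ ↔ b₂.pos < b₁.pos ∨ (b₁.pos = b₂.pos ∧ B.pos % 2 = 0) := by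
  rw [WinsBid, lt_iff_pos, adv_eq_false_iff_pos, pos_injective.eq_iff]

theorem step_le_total {c : G.Config} (hc : c.2 ≤ G.total) {a₁ a₂ : G.Action}
    (h₁ : G.LegalAction₁ c a₁) (h₂ : G.LegalAction₂ c a₂) : (G.step c a₁ a₂).2 ≤ G.total := by
  have h₁' := h₁.1.1
  have h₂' := h₂.1.1
  rw [le_iff_pos] at *
  by_cases hw : WinsBid c.2 a₁.1 a₂.1
  · rw [step_of_wins _ hw]
    change (c.2.ominus a₁.1).pos ≤ _
    rw [pos_ominus h₁']
    omega
  · rw [step_of_not_wins _ hw]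
    change (c.2.oplus a₂.1).pos ≤ _
    rw [pos_ominus hc] at h₂'
    rw [pos_oplus]
    omega

/-- Player 1 can force the next configuration to satisfy `X`. -/
def Forces₁ (c : G.Config) (X : G.Config → Prop) : Prop :=
  ∃ a₁, G.LegalAction₁ c a₁ ∧ ∀ a₂, G.LegalAction₂ c a₂ → X (G.step c a₁ a₂)

/-- Player 2 can force the next configuration to satisfy `X`. -/
def Forces₂ (c : G.Config) (X : G.Config → Prop) : Prop :=
  ∃ a₂, G.LegalAction₂ c a₂ ∧ ∀ a₁, G.LegalAction₁ c a₁ → X (G.step c a₁ a₂)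

variable {G} in
theorem Forces₁.mono {c : G.Config} {X Y : G.Config → Prop} (hXY : ∀ c', X c' → Y c')
    (h : G.Forces₁ c X) : G.Forces₁ c Y :=
  let ⟨a, ha, h⟩ := h
  ⟨a, ha, fun a₂ h₂ => hXY _ (h a₂ h₂)⟩

/-- A single turn is determined. -/
theorem forces_or_forces (c : G.Config) (X : G.Config → Prop) :
    G.Forces₁ c X ∨ G.Forces₂ c fun c' => ¬ X c' := by
  obtain ⟨v, B⟩ := c
  let P : StarNat → Prop := fun b => LegalBid B b ∧ ∃ u, G.Edge v u ∧ X (u, B.ominus b)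
  let Q : StarNat → Prop := fun b =>
    LegalBid (G.total.ominus B) b ∧ ∃ u, G.Edge v u ∧ ¬ X (u, B.oplus b)
  obtain ⟨u₀, hu₀⟩ := G.exists_edge v
  by_cases hP : ∃ b, P b
  swap
  -- With no useful bid for Player 1, the bid 0 suffices for Player 2: winning with it leaves the
  -- budgets unchanged, so reaching `X` would make 0 a useful bid for Player 1.
  · refine Or.inr ⟨(ofPos 0, u₀), ⟨legalBid_zero _, hu₀⟩, fun a₁ h₁ hX => hP ?_⟩
    by_cases hw : WinsBid B a₁.1 (ofPos 0)
    · rw [step_of_wins _ hw] at hX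
      exact ⟨a₁.1, h₁.1, a₁.2, h₁.2, hX⟩
    · rw [step_of_not_wins _ hw] at hX
      refine ⟨ofPos 0, legalBid_zero _, u₀, hu₀, ?_⟩
      rw [ominus_zero]
      simpa only [oplus_zero] using hX
  by_cases hQ : ∃ b, Q b
  swap
  · refine Or.inl ⟨(ofPos 0, u₀), ⟨legalBid_zero _, hu₀⟩, fun a₂ h₂ => ?_⟩
    by_contra hX
    refine hQ ?_
    by_cases hw : WinsBid B (ofPos 0) a₂.1
    · rw [step_of_wins _ hw] at hX
      refine ⟨ofPos 0, legalBid_zero _, u₀, hu₀, ?_⟩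
      rw [oplus_zero]
      simpa only [ominus_zero] using hX
    · rw [step_of_not_wins _ hw] at hX
      exact ⟨a₂.1, h₂.1, a₂.2, h₂.2, hX⟩
  obtain ⟨b₁, ⟨hb₁, u₁, hu₁, hX₁⟩, hmax₁⟩ := exists_greatest B (fun b hb => hb.1.1) hP
  obtain ⟨b₂, ⟨hb₂, u₂, hu₂, hX₂⟩, hmax₂⟩ :=
    exists_greatest (G.total.ominus B) (fun b hb => hb.1.1) hQ
  -- The player whose greatest useful bid prevails plays it. An opponent can win the bidding only by
  -- exceeding his own greatest useful bid, hence to no avail.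
  by_cases hb : WinsBid B b₁ b₂
  · refine Or.inl ⟨(b₁, u₁), ⟨hb₁, hu₁⟩, fun a₂ h₂ => ?_⟩
    by_cases hw : WinsBid B b₁ a₂.1
    · rw [step_of_wins _ hw]
      exact hX₁
    · rw [step_of_not_wins _ hw]
      by_contra hX
      have := hmax₂ a₂.1 ⟨h₂.1, a₂.2, h₂.2, hX⟩
      rw [le_iff_pos] at this
      rw [winsBid_iff_pos] at hb hw
      omega
  · refine Or.inr ⟨(b₂, u₂), ⟨hb₂, hu₂⟩, fun a₁ h₁ => ?_⟩
    by_cases hw : WinsBid B a₁.1 b₂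
    · rw [step_of_wins _ hw]
      intro hX
      have := hmax₁ a₁.1 ⟨h₁.1, a₁.2, h₁.2, hX⟩
      rw [le_iff_pos] at this
      rw [winsBid_iff_pos] at hb hw
      omega
    · rw [step_of_not_wins _ hw]
      exact hX₂

/-- A larger budget is better, one position up. -/
theorem Forces₁.succ_budget {v : V} {B B' : StarNat} (hBB' : B'.pos = B.pos + 1)
    (hB' : B' ≤ G.total) {X : G.Config → Prop}
    (hX : ∀ u C C', C ≤ C' → C' ≤ G.total → X (u, C) → X (u, C'))
    (h : G.Forces₁ (v, B) X) : G.Forces₁ (v, B') X := by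
  obtain ⟨⟨b, u⟩, ⟨hb, hu⟩, h⟩ := h
  have hbB := hb.1
  change LegalBid B b at hb
  change b ≤ B at hbB
  rw [legalBid_iff_pos] at hb
  have hB : B ≤ G.total := by rw [le_iff_pos] at *; omega
  have hmB := pos_ominus hB
  have hmB' := pos_ominus hB'
  have hT := G.pos_total
  have hBT := hB
  have hBT' := hB'
  rw [le_iff_pos] at hBT hBT'
  -- Drop the star of `b`, if any. A star on `b` means that `B` holds the advantage; then `B'` does
  -- not, but wins ties instead.
  let b' := ofPos (2 * (b.pos / 2))
  have hb' : b'.pos = 2 * (b.pos / 2) := pos_ofPos _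
  have hlb' : LegalBid B' b' := by rw [legalBid_iff_pos]; omega
  have hmb := pos_ominus hbB
  have hmb' := pos_ominus hlb'.1
  refine ⟨(b', u), ⟨hlb', hu⟩, fun ⟨r', u'⟩ ⟨hr', hu'⟩ => ?_⟩
  change LegalBid (G.total.ominus B') r' at hr'
  rw [legalBid_iff_pos] at hr'
  by_cases hw : WinsBid B' b' r'
  · rw [step_of_wins _ hw]
    -- Let Player 2 bid 0 and also aim at `u`, so that the token reaches `u` whoever wins the
    -- bidding at `B`.
    have h0 := h (ofPos 0, u) ⟨legalBid_zero _, hu⟩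
    have hle : B'.ominus b' ≤ G.total := by rw [le_iff_pos]; omega
    by_cases hw0 : WinsBid B b (ofPos 0)
    · rw [step_of_wins _ hw0] at h0
      refine hX _ _ _ ?_ hle h0
      rw [le_iff_pos]
      change (B.ominus b).pos ≤ (B'.ominus b').pos
      omega
    · rw [step_of_not_wins _ hw0] at h0
      refine hX _ _ _ ?_ hle h0
      rw [le_iff_pos, oplus_zero]
      rw [winsBid_iff_pos, pos_ofPos] at hw0
      change B.pos ≤ (B'.ominus b').pos
      omega
  · rw [step_of_not_wins _ hw]
    rw [winsBid_iff_pos] at hw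
    -- The winning reply `r'` at `B'` is matched by one at `B`. Player 2 has one position more there
    -- and pays it, unless that would require a star without the advantage; then `r'` itself still
    -- wins.
    obtain ⟨r, hr, hrb, hle⟩ : ∃ r : ℕ, LegalBid (G.total.ominus B) (ofPos r) ∧
        ¬ WinsBid B b (ofPos r) ∧ B.pos + r ≤ B'.pos + r'.pos := by
      by_cases hodd : B.pos % 2 = 1 ∧ r'.pos % 2 = 0
      · refine ⟨r'.pos, ?_, ?_, ?_⟩
        · rw [legalBid_iff_pos, pos_ofPos]; omega
        · rw [winsBid_iff_pos, pos_ofPos]; omega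
        · omega
      · refine ⟨r'.pos + 1, ?_, ?_, ?_⟩
        · rw [legalBid_iff_pos, pos_ofPos]; omega
        · rw [winsBid_iff_pos, pos_ofPos]; omega
        · omega
    have h1 := h (ofPos r, u') ⟨hr, hu'⟩
    rw [step_of_not_wins _ hrb] at h1
    refine hX _ _ _ ?_ ?_ h1
    · rw [le_iff_pos]
      change (B.oplus (ofPos r)).pos ≤ (B'.oplus r').pos
      rw [pos_oplus, pos_oplus, pos_ofPos]
      exact hle
    · rw [le_iff_pos]
      change (B'.oplus r').pos ≤ _
      rw [pos_oplus]
      omega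

/-- A larger budget is better. -/
theorem Forces₁.mono_budget {v : V} {B B' : StarNat} (hBB' : B ≤ B')
    (hB' : B' ≤ G.total) {X : G.Config → Prop}
    (hX : ∀ u C C', C ≤ C' → C' ≤ G.total → X (u, C) → X (u, C'))
    (h : G.Forces₁ (v, B) X) : G.Forces₁ (v, B') X := by
  have key : ∀ n, B.pos + n ≤ G.total.pos → G.Forces₁ (v, ofPos (B.pos + n)) X := by
    intro n
    induction n with
    | zero =>
      intro _
      rwa [show ofPos (B.pos + 0) = B from pos_injective (by simp)]
    | succ n ih =>
      intro hn
      exact Forces₁.succ_budget G (by simp [add_assoc]) (by rwa [le_iff_pos, pos_ofPos]) hX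
        (ih (by omega))
  rw [le_iff_pos] at hBB' hB'
  have := key (B'.pos - B.pos) (by omega)
  rwa [show ofPos (B.pos + (B'.pos - B.pos)) = B' from
    pos_injective (by rw [pos_ofPos]; omega)] at this

/-! ### Survival for finitely many turns and its limit -/

/-- From energy `M`, Preserver can keep the energy non-negative during the first `n` turns. -/
def Survives : ℕ → G.Config → ℤ → Prop
  | 0, _, _ => True
  | n + 1, c, M => 0 ≤ M ∧ G.Forces₁ c fun c' => Survives n c' (M + G.weight c.1 c'.1)

variable {G} in
theorem Survives.mono_energy {n : ℕ} {c : G.Config} {M M' : ℤ} (hM : M ≤ M')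
    (h : G.Survives n c M) : G.Survives n c M' := by
  induction n generalizing c M M' with
  | zero => trivial
  | succ n ih => exact ⟨hM.trans' h.1, h.2.mono fun c' => ih (by omega)⟩

variable {G} in
theorem Survives.of_succ {n : ℕ} {c : G.Config} {M : ℤ} (h : G.Survives (n + 1) c M) :
    G.Survives n c M := by
  induction n generalizing c M with
  | zero => trivial
  | succ n ih => exact ⟨h.1, h.2.mono fun c' => ih⟩

variable {G} in
theorem Survives.anti {m n : ℕ} (hmn : m ≤ n) {c : G.Config} {M : ℤ} (h : G.Survives n c M) :
    G.Survives m c M := by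
  induction n, hmn using Nat.le_induction with
  | base => exact h
  | succ n _ ih => exact ih h.of_succ

variable {G} in
theorem Survives.mono_budget {n : ℕ} {v : V} {B B' : StarNat} {M : ℤ} (hBB' : B ≤ B')
    (hB' : B' ≤ G.total) (h : G.Survives n (v, B) M) : G.Survives n (v, B') M := by
  induction n generalizing v B B' M with
  | zero => trivial
  | succ n ih =>
    exact ⟨h.1, Forces₁.mono_budget G hBB' hB' (fun u C C' hC hC' => ih hC hC') h.2⟩

theorem forces₂_of_not_survives {n : ℕ} {c : G.Config} {M : ℤ} (hM : 0 ≤ M)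
    (h : ¬ G.Survives (n + 1) c M) :
    G.Forces₂ c fun c' => ¬ G.Survives n c' (M + G.weight c.1 c'.1) :=
  (G.forces_or_forces c _).resolve_left fun h' => h ⟨hM, h'⟩

/-- From energy `M`, Preserver can keep the energy non-negative for any number of turns. -/
def SurvivesAlways (c : G.Config) (M : ℤ) : Prop := ∀ n, G.Survives n c M

theorem finite_legalAction₁ [Finite V] (c : G.Config) : {a | G.LegalAction₁ c a}.Finite :=
  ((finite_Iic c.2).prod Set.finite_univ).subset fun _ h => ⟨h.1.1, trivial⟩

variable {G} in
-- Compactness: against a spoiling action of Player 2, each of the finitely many actions of Player 1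
-- would fail within some horizon, hence all within a common `n`, contradicting survival for `n + 1`
-- turns.
theorem SurvivesAlways.forces₁ [Finite V] {c : G.Config} {M : ℤ} (h : G.SurvivesAlways c M) :
    G.Forces₁ c fun c' => G.SurvivesAlways c' (M + G.weight c.1 c'.1) := by
  refine (G.forces_or_forces c _).resolve_right ?_
  rintro ⟨a₂, h₂, ha₂⟩
  have key : ∀ a₁ ∈ {a | G.LegalAction₁ c a}, ∀ᶠ n in atTop,
      ¬ G.Survives n (G.step c a₁ a₂) (M + G.weight c.1 (G.step c a₁ a₂).1) := by
    intro a₁ h₁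
    obtain ⟨n, hn⟩ := not_forall.1 (ha₂ a₁ h₁)
    filter_upwards [eventually_ge_atTop n] with m hm h' using hn (h'.anti hm)
  obtain ⟨n, hn⟩ := ((eventually_all_finite (G.finite_legalAction₁ c)).2 key).exists
  obtain ⟨a₁, h₁, h'⟩ := (h (n + 1)).2
  exact hn a₁ h₁ (h' a₂ h₂)

theorem SurvivesAlways.nonneg {c : G.Config} {M : ℤ} (h : G.SurvivesAlways c M) : 0 ≤ M :=
  (h 1).1

/-! ### From one-turn forcing to strategies with memory -/

section Strategies

variable {S : Type*}

/-- A strategy that keeps a state in memory, plays the action `act` of the current state, and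
chooses the next state according to `Rel` whenever this is possible. -/
theorem exists_memory_strategy (cfg : S → G.Config) (Rel : S → S → Prop) (act : S → G.Action)
    (legal : G.Config → G.Action → Prop) (hlegal : ∀ c, ∃ a, legal c a) (s₀ : S) :
    ∃ τ : G.Strategy, (∀ h c, legal c (τ h c)) ∧
      ∀ (c : ℕ → G.Config) (hist : ℕ → List G.Config), hist 0 = [] →
        (∀ n, hist (n + 1) = hist n ++ [c n]) →
        ∃ s : ℕ → S, s 0 = s₀ ∧ ∀ n,
          (legal (c n) (act (s n)) → τ (hist n) (c n) = act (s n)) ∧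
          ((∃ s', cfg s' = c (n + 1) ∧ Rel (s n) s') →
            cfg (s (n + 1)) = c (n + 1) ∧ Rel (s n) (s (n + 1))) := by
  classical
  choose dflt hdflt using hlegal
  let next : S → G.Config → S := fun s c =>
    if h : ∃ s', cfg s' = c ∧ Rel s s' then h.choose else s
  -- The initial configuration is dropped because `s₀` already accounts for it.
  let mem : List G.Config → S := fun l => l.tail.foldl next s₀
  refine ⟨fun h c => if legal c (act (mem (h ++ [c]))) then act (mem (h ++ [c])) else dflt c,
    fun h c => ?_, fun c hist h0 hsucc => ⟨fun n => mem (hist n ++ [c n]), ?_, fun n => ⟨?_, ?_⟩⟩⟩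
  · dsimp only
    split_ifs with hl
    exacts [hl, hdflt c]
  · simp [h0, mem]
  · intro hl
    exact if_pos hl
  · intro hex
    have hmem : mem (hist (n + 1) ++ [c (n + 1)]) = next (mem (hist n ++ [c n])) (c (n + 1)) := by
      rw [hsucc]
      simp only [mem]
      rw [List.tail_append_of_ne_nil (by simp), List.foldl_append]
      rfl
    have hnext : next (mem (hist n ++ [c n])) (c (n + 1)) = hex.choose := dif_pos hex
    dsimp only
    rw [hmem, hnext]
    exact hex.choose_spec

/-- A state bundles a configuration with bookkeeping data and an invariant. If a related state can
be forced in each turn, the whole play follows a `Rel`-chain. -/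
theorem exists_strategy₁ (cfg : S → G.Config) (Rel : S → S → Prop)
    (hB : ∀ s, (cfg s).2 ≤ G.total)
    (h : ∀ s, G.Forces₁ (cfg s) fun c' => ∃ s', cfg s' = c' ∧ Rel s s') (s₀ : S) :
    ∃ σ, G.Legal₁ σ ∧ ∀ τ, G.Legal₂ τ → ∃ s : ℕ → S, s 0 = s₀ ∧
      ∀ n, (G.run (cfg s₀) σ τ n).2 = cfg (s n) ∧ Rel (s n) (s (n + 1)) := by
  choose act hact hstep using h
  obtain ⟨σ, hσ, hmem⟩ :=
    G.exists_memory_strategy cfg Rel act G.LegalAction₁ G.exists_legalAction₁ s₀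
  refine ⟨σ, fun h v B _ => hσ h (v, B), fun τ hτ => ?_⟩
  obtain ⟨s, hs0, hs⟩ := hmem (fun n => (G.run (cfg s₀) σ τ n).2)
    (fun n => (G.run (cfg s₀) σ τ n).1) rfl (fun n => rfl)
  have key : ∀ n, (G.run (cfg s₀) σ τ n).2 = cfg (s n) →
      cfg (s (n + 1)) = (G.run (cfg s₀) σ τ (n + 1)).2 ∧ Rel (s n) (s (n + 1)) := by
    intro n hn
    refine (hs n).2 ?_
    have ha := (hs n).1 (hn ▸ hact (s n))
    change ∃ s', cfg s' = G.step _ _ _ ∧ _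
    rw [ha, hn]
    exact hstep (s n) _ (hτ _ _ _ (hB _))
  have hcfg : ∀ n, (G.run (cfg s₀) σ τ n).2 = cfg (s n) := by
    intro n
    induction n with
    | zero => rw [hs0]; rfl
    | succ n ih => exact (key n ih).1.symm
  exact ⟨s, hs0, fun n => ⟨hcfg n, (key n (hcfg n)).2⟩⟩

theorem exists_strategy₂ (cfg : S → G.Config) (Rel : S → S → Prop)
    (hB : ∀ s, (cfg s).2 ≤ G.total)
    (h : ∀ s, G.Forces₂ (cfg s) fun c' => ∃ s', cfg s' = c' ∧ Rel s s') (s₀ : S) :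
    ∃ τ, G.Legal₂ τ ∧ ∀ σ, G.Legal₁ σ → ∃ s : ℕ → S, s 0 = s₀ ∧
      ∀ n, (G.run (cfg s₀) σ τ n).2 = cfg (s n) ∧ Rel (s n) (s (n + 1)) := by
  choose act hact hstep using h
  obtain ⟨τ, hτ, hmem⟩ :=
    G.exists_memory_strategy cfg Rel act G.LegalAction₂ G.exists_legalAction₂ s₀
  refine ⟨τ, fun h v B _ => hτ h (v, B), fun σ hσ => ?_⟩
  obtain ⟨s, hs0, hs⟩ := hmem (fun n => (G.run (cfg s₀) σ τ n).2)
    (fun n => (G.run (cfg s₀) σ τ n).1) rfl (fun n => rfl)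
  have key : ∀ n, (G.run (cfg s₀) σ τ n).2 = cfg (s n) →
      cfg (s (n + 1)) = (G.run (cfg s₀) σ τ (n + 1)).2 ∧ Rel (s n) (s (n + 1)) := by
    intro n hn
    refine (hs n).2 ?_
    have ha := (hs n).1 (hn ▸ hact (s n))
    change ∃ s', cfg s' = G.step _ _ _ ∧ _
    rw [ha, hn]
    exact hstep (s n) _ (hσ _ _ _ (hB _))
  have hcfg : ∀ n, (G.run (cfg s₀) σ τ n).2 = cfg (s n) := by
    intro n
    induction n with
    | zero => rw [hs0]; rfl
    | succ n ih => exact (key n ih).1.symm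
  exact ⟨s, hs0, fun n => ⟨hcfg n, (key n (hcfg n)).2⟩⟩

end Strategies

/-! ### The energy objective -/

theorem sumWeights_succ (π : ℕ → V) (m : ℕ) :
    G.sumWeights π (m + 1) = G.sumWeights π m + G.weight (π m) (π (m + 1)) :=
  Finset.sum_range_succ _ _

theorem sumWeights_zero (π : ℕ → V) : G.sumWeights π 0 = 0 := rfl

theorem Forces₁.and_le_total {c : G.Config} (hc : c.2 ≤ G.total) {X : G.Config → Prop}
    (h : G.Forces₁ c X) : G.Forces₁ c fun c' => c'.2 ≤ G.total ∧ X c' :=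
  let ⟨a, ha, h⟩ := h
  ⟨a, ha, fun a₂ h₂ => ⟨G.step_le_total hc ha h₂, h a₂ h₂⟩⟩

theorem Forces₂.and_le_total {c : G.Config} (hc : c.2 ≤ G.total) {X : G.Config → Prop}
    (h : G.Forces₂ c X) : G.Forces₂ c fun c' => c'.2 ≤ G.total ∧ X c' :=
  let ⟨a, ha, h⟩ := h
  ⟨a, ha, fun a₁ h₁ => ⟨G.step_le_total hc h₁ ha, h a₁ h₁⟩⟩

theorem forces₂_true (c : G.Config) : G.Forces₂ c fun _ => True :=
  let ⟨a, ha⟩ := G.exists_legalAction₂ c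
  ⟨a, ha, fun _ _ => trivial⟩

theorem presWins_of_survivesAlways [Finite V] {v : V} {B : G.Budget} {M : ℤ}
    (h : G.SurvivesAlways (v, B.1) M) : G.PresWins M v B := by
  let S := {s : G.Config × ℤ // s.1.2 ≤ G.total ∧ G.SurvivesAlways s.1 s.2}
  obtain ⟨σ, hσ, hrun⟩ := G.exists_strategy₁ (S := S) (fun s => s.1.1)
    (fun s s' => s'.1.2 = s.1.2 + G.weight s.1.1.1 s'.1.1.1) (fun s => s.2.1)
    (fun s => (Forces₁.and_le_total G s.2.1 s.2.2.forces₁).mono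
      fun c' hc' => ⟨⟨(c', _), hc'⟩, rfl, rfl⟩) ⟨((v, B.1), M), B.2, h⟩
  refine ⟨σ, hσ, fun τ hτ m => ?_⟩
  obtain ⟨s, hs0, hs⟩ := hrun τ hτ
  have key : ∀ m, (s m).1.2 = M + G.sumWeights (G.path (v, B.1) σ τ) m := by
    intro m
    induction m with
    | zero => simp [hs0, sumWeights_zero]
    | succ m ih =>
      rw [(hs m).2, ih, sumWeights_succ, path, path, (hs m).1, (hs (m + 1)).1, add_assoc]
  rw [← key]
  exact SurvivesAlways.nonneg G (s m).2.2

/-- Consumer remembers the energy and a horizon within which survival fails. The horizon decreases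
as long as the energy is non-negative, so this cannot last. -/
theorem consWins_of_not_survivesAlways {v : V} {B : G.Budget} {M : ℤ}
    (h : ¬ G.SurvivesAlways (v, B.1) M) : G.ConsWins M v B := by
  obtain ⟨n, hn⟩ := not_forall.1 h
  let S := {s : G.Config × ℤ × ℕ // s.1.2 ≤ G.total ∧ ¬ G.Survives s.2.2 s.1 s.2.1}
  obtain ⟨τ, hτ, hrun⟩ := G.exists_strategy₂ (S := S) (fun s => s.1.1)
    (fun s s' => 0 ≤ s.1.2.1 →
      s'.1.2.1 = s.1.2.1 + G.weight s.1.1.1 s'.1.1.1 ∧ s'.1.2.2 < s.1.2.2) (fun s => s.2.1)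
    (by
      rintro ⟨⟨c, M, n⟩, hc, hn⟩
      by_cases hM : 0 ≤ M
      · cases n with
        | zero => exact absurd trivial hn
        | succ n =>
          obtain ⟨a, ha, h⟩ := Forces₂.and_le_total G hc (G.forces₂_of_not_survives hM hn)
          exact ⟨a, ha, fun a₁ h₁ => ⟨⟨(_, _, n), h a₁ h₁⟩, rfl, fun _ => ⟨rfl, n.lt_succ_self⟩⟩⟩
      -- Consumer has already won; energy `-1` with horizon 1 is a dummy state that satisfies the
      -- invariant at any configuration.
      · obtain ⟨a, ha, h⟩ := Forces₂.and_le_total G hc (G.forces₂_true c)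
        exact ⟨a, ha, fun a₁ h₁ => ⟨⟨(_, -1, 1), (h a₁ h₁).1, fun h' => absurd h'.1 (by simp)⟩,
          rfl, fun h => absurd h hM⟩⟩) ⟨((v, B.1), M, n), B.2, hn⟩
  refine ⟨τ, hτ, fun σ hσ => ?_⟩
  obtain ⟨s, hs0, hs⟩ := hrun σ hσ
  by_contra! hcon
  have key : ∀ m, (s m).1.2.1 = M + G.sumWeights (G.path (v, B.1) σ τ) m ∧
      (s m).1.2.2 + m ≤ n := by
    intro m
    induction m with
    | zero => simp [hs0, sumWeights_zero]
    | succ m ih =>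
      obtain ⟨h1, h2⟩ := (hs m).2 (by rw [ih.1]; exact hcon m)
      refine ⟨?_, by omega⟩
      rw [h1, ih.1, sumWeights_succ, path, path, (hs m).1, (hs (m + 1)).1, add_assoc]
  have := (key (n + 1)).2
  omega

/-! ### Estimates for the mean payoff -/

theorem exists_weight_bound [Finite V] : ∃ K : ℕ, ∀ v u, |G.weight v u| ≤ K := by
  obtain ⟨K, hK⟩ := (eventually_all (ι := V × V) (l := atTop)
    (p := fun p (K : ℕ) => |G.weight p.1 p.2| ≤ K)).2
    (fun p => by
      filter_upwards [eventually_ge_atTop (G.weight p.1 p.2).natAbs] with K hK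
      rw [Int.abs_eq_natAbs]
      exact_mod_cast hK) |>.exists
  exact ⟨K, fun v u => hK (v, u)⟩

theorem abs_sumWeights_le {K : ℕ} (hK : ∀ v u, |G.weight v u| ≤ K) (π : ℕ → V) (m : ℕ) :
    |G.sumWeights π m| ≤ m * K := by
  refine (Finset.abs_sum_le_sum_abs _ _).trans ((Finset.sum_le_sum fun j _ => hK _ _).trans ?_)
  simp

theorem abs_average_le {K : ℕ} (hK : ∀ v u, |G.weight v u| ≤ K) (π : ℕ → V) (m : ℕ) :
    |1 / (m : ℝ) * (G.sumWeights π m : ℝ)| ≤ K := by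
  rcases m.eq_zero_or_pos with rfl | hm
  · simp
  have h : |(G.sumWeights π m : ℝ)| ≤ m * K := by exact_mod_cast G.abs_sumWeights_le hK π m
  have hm' : (0 : ℝ) < m := by exact_mod_cast hm
  rw [abs_mul, abs_of_pos (by positivity), one_div, inv_mul_le_iff₀ hm']
  exact h

theorem isBoundedUnder_ge_average {K : ℕ} (hK : ∀ v u, |G.weight v u| ≤ K) (π : ℕ → V) :
    IsBoundedUnder (· ≥ ·) atTop fun m : ℕ => 1 / (m : ℝ) * (G.sumWeights π m : ℝ) :=
  isBoundedUnder_of ⟨-K, fun m => (abs_le.1 (G.abs_average_le hK π m)).1⟩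

theorem isBoundedUnder_le_average {K : ℕ} (hK : ∀ v u, |G.weight v u| ≤ K) (π : ℕ → V) :
    IsBoundedUnder (· ≤ ·) atTop fun m : ℕ => 1 / (m : ℝ) * (G.sumWeights π m : ℝ) :=
  isBoundedUnder_of ⟨K, fun m => (abs_le.1 (G.abs_average_le hK π m)).2⟩

theorem meanPayoff_nonneg [Finite V] {π : ℕ → V} {M : ℤ}
    (h : ∀ m, 0 ≤ M + G.sumWeights π m) : 0 ≤ G.meanPayoff π := by
  obtain ⟨K, hK⟩ := G.exists_weight_bound
  have hlim : Tendsto (fun m : ℕ => -(M : ℝ) / m) atTop (nhds 0) :=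
    tendsto_const_div_atTop_nhds_zero_nat _
  rw [← hlim.liminf_eq]
  refine liminf_le_liminf (Eventually.of_forall fun m => ?_) hlim.isBoundedUnder_ge
    (G.isBoundedUnder_le_average hK π).isCoboundedUnder_ge
  have : (0 : ℝ) ≤ M + G.sumWeights π m := by exact_mod_cast h m
  rw [div_eq_inv_mul, one_div]
  exact mul_le_mul_of_nonneg_left (by linarith) (by positivity)

/-- The hypothesis bounds the averages by `(C / N) / m - 1 / N`, which tends to `-1 / N`. -/
theorem meanPayoff_neg [Finite V] {π : ℕ → V} {N : ℕ} (hN : 0 < N) {C : ℤ}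
    (h : ∀ m : ℕ, N * G.sumWeights π m + m ≤ C) : G.meanPayoff π < 0 := by
  obtain ⟨K, hK⟩ := G.exists_weight_bound
  have hN' : (0 : ℝ) < N := by exact_mod_cast hN
  have hlim : Tendsto (fun m : ℕ => (C / N : ℝ) / m - 1 / N) atTop (nhds (0 - 1 / N)) :=
    (tendsto_const_div_atTop_nhds_zero_nat _).sub_const _
  refine lt_of_le_of_lt (b := 0 - 1 / (N : ℝ)) ?_ (by rw [zero_sub, neg_lt_zero]; positivity)
  rw [← hlim.liminf_eq]
  refine liminf_le_liminf ?_ (G.isBoundedUnder_ge_average hK π)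
    hlim.isBoundedUnder_le.isCoboundedUnder_ge
  filter_upwards [eventually_gt_atTop 0] with m hm
  have hm' : (0 : ℝ) < m := by exact_mod_cast hm
  have : (N : ℝ) * G.sumWeights π m + m ≤ C := by exact_mod_cast h m
  have h2 : (C / N : ℝ) / m - 1 / N - 1 / (m : ℝ) * (G.sumWeights π m : ℝ) =
      (C - (N * G.sumWeights π m + m)) / (N * m) := by
    field_simp
    ring
  have h3 : 0 ≤ (C - (N * G.sumWeights π m + m) : ℝ) / (N * m) :=
    div_nonneg (by linarith) (by positivity)
  linarith

theorem maxWins_of_presWins [Finite V] {v : V} {B : G.Budget} {M : ℤ} (h : G.PresWins M v B) :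
    G.MaxWins v B :=
  let ⟨σ, hσ, h⟩ := h
  ⟨σ, hσ, fun τ hτ => G.meanPayoff_nonneg (h τ hτ)⟩

/-! ### Uniform bounds and the strategy of Minimizer -/

instance : Finite G.Budget := finite_Iic G.total

/-- There is a common bound on the energies that are needed where a finite energy suffices. -/
theorem exists_energy_bound [Finite V] : ∃ D : ℕ, ∀ v B, B ≤ G.total →
    (∃ M, G.SurvivesAlways (v, B) M) → G.SurvivesAlways (v, B) D := by
  obtain ⟨D, hD⟩ := (eventually_all (ι := V × G.Budget) (l := atTop)
    (p := fun p (D : ℕ) => (∃ M, G.SurvivesAlways (p.1, p.2.1) M) →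
      G.SurvivesAlways (p.1, p.2.1) D)).2
    (fun p => by
      by_cases hex : ∃ M, G.SurvivesAlways (p.1, p.2.1) M
      · obtain ⟨M, hM⟩ := hex
        filter_upwards [eventually_ge_atTop M.toNat] with D hD _ n
        exact (hM n).mono_energy (by omega)
      · exact Eventually.of_forall fun D h => absurd h hex) |>.exists
  exact ⟨D, fun v B hB => hD (v, ⟨B, hB⟩)⟩

/-- There is a common number of turns within which Consumer can exhaust the energy `M` from the
configurations in which no energy suffices. -/
theorem exists_turn_bound [Finite V] (M : ℤ) : ∃ N : ℕ, ∀ v B, B ≤ G.total →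
    (∀ M, ¬ G.SurvivesAlways (v, B) M) → ¬ G.Survives N (v, B) M := by
  obtain ⟨N, hN⟩ := (eventually_all (ι := V × G.Budget) (l := atTop)
    (p := fun p (N : ℕ) => (∀ M, ¬ G.SurvivesAlways (p.1, p.2.1) M) →
      ¬ G.Survives N (p.1, p.2.1) M)).2
    (fun p => by
      by_cases hex : ∀ M, ¬ G.SurvivesAlways (p.1, p.2.1) M
      · obtain ⟨n, hn⟩ := not_forall.1 (hex M)
        filter_upwards [eventually_ge_atTop n] with N hN _ h'
        exact hn (h'.anti hN)
      · exact Eventually.of_forall fun D h => absurd h hex) |>.exists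
  exact ⟨N, fun v B hB => hN (v, ⟨B, hB⟩)⟩

/-- Where no energy suffices, Minimizer lets the energy drop by one again and again, each time
within a bounded number of turns and without leaving the region where no energy suffices. -/
theorem minWins_of_not_survivesAlways [Finite V] {v : V} {B : G.Budget}
    (h : ∀ M, ¬ G.SurvivesAlways (v, B.1) M) : G.MinWins v B := by
  obtain ⟨K, hK⟩ := G.exists_weight_bound
  obtain ⟨D, hD⟩ := G.exists_energy_bound
  have hinf : ∀ (c : G.Config) (M : ℤ) (n : ℕ), c.2 ≤ G.total → (D : ℤ) ≤ M →
      ¬ G.Survives n c M → ∀ M', ¬ G.SurvivesAlways c M' := fun c M n hc hM hn M' hM' =>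
    hn ((hD c.1 c.2 hc ⟨M', hM'⟩ n).mono_energy hM)
  -- Each round starts with virtual energy `M₀` and ends once that falls to `D + K` or below. A turn
  -- costs at most `K`, so at least `D` is left, and by `hinf` no energy suffices there either.
  let M₀ : ℤ := D + K + 1
  obtain ⟨N, hN⟩ := G.exists_turn_bound M₀
  have hNpos : 0 < N := by
    by_contra hcon
    obtain rfl : N = 0 := by omega
    exact hN v B.1 B.2 h trivial
  -- The data are the virtual energy and the turns left in the round. The last condition bounds the
  -- virtual energy above: each turn gains at most `K` and uses up one turn.
  let S := {s : G.Config × ℤ × ℕ // s.1.2 ≤ G.total ∧ ¬ G.Survives s.2.2 s.1 s.2.1 ∧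
    (D + K : ℤ) < s.2.1 ∧ s.2.1 + s.2.2 * K ≤ M₀ + N * K}
  obtain ⟨τ, hτ, hrun⟩ := G.exists_strategy₂ (S := S) (fun s => s.1.1)
    -- The potential is `N` times the virtual energy minus the turns left. A reset raises the
    -- virtual energy by at least 1, hence the first term by at least `N`, which pays for restoring
    -- the counter to `N`.
    (fun s s' => N * G.weight s.1.1.1 s'.1.1.1 + 1 ≤
      (N * s'.1.2.1 - s'.1.2.2) - (N * s.1.2.1 - s.1.2.2)) (fun s => s.2.1)
    (by
      rintro ⟨⟨c, M, n⟩, hc, hn, hM, hle⟩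
      dsimp only at hc hn hM hle
      cases n with
      | zero => exact absurd trivial hn
      | succ n =>
        obtain ⟨a, ha, h⟩ :=
          Forces₂.and_le_total G hc (G.forces₂_of_not_survives (by omega) hn)
        refine ⟨a, ha, fun a₁ h₁ => ?_⟩
        obtain ⟨hc', hn'⟩ := h a₁ h₁
        set c' := G.step c a₁ a
        have hw := abs_le.1 (hK c.1 c'.1)
        push_cast at hle
        by_cases hlt : (D + K : ℤ) < M + G.weight c.1 c'.1
        · refine ⟨⟨(c', M + G.weight c.1 c'.1, n), hc', hn', hlt, ?_⟩, rfl, ?_⟩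
          · dsimp only
            linarith
          · push_cast
            linarith
        · refine ⟨⟨(c', M₀, N), hc', hN c'.1 c'.2 hc' (hinf c' _ n hc' (by omega) hn'), ?_, le_rfl⟩,
            rfl, ?_⟩
          · simp [M₀]
          · have : (N : ℤ) * (G.weight c.1 c'.1 + 1) ≤ N * (M₀ - M) :=
              mul_le_mul_of_nonneg_left (by omega) (by positivity)
            push_cast
            linarith)
    ⟨((v, B.1), M₀, N), B.2, hN v B.1 B.2 h, by simp [M₀], le_rfl⟩
  refine ⟨τ, hτ, fun σ hσ => ?_⟩
  obtain ⟨s, hs0, hs⟩ := hrun σ hσ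
  have key : ∀ m : ℕ, N * G.sumWeights (G.path (v, B.1) σ τ) m + m ≤
      (N * (s m).1.2.1 - (s m).1.2.2) - (N * M₀ - N) := by
    intro m
    induction m with
    | zero => simp [hs0, sumWeights_zero]
    | succ m ih =>
      have h1 := (hs m).2
      rw [sumWeights_succ, path, path, (hs m).1, (hs (m + 1)).1]
      push_cast
      linarith
  refine G.meanPayoff_neg hNpos (C := N * (M₀ + N * K) - (N * M₀ - N)) fun m => (key m).trans ?_
  have h1 := (s m).2.2.2.2
  have h2 : (0 : ℤ) ≤ (s m).1.2.2 * K := by positivity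
  have h3 : (N : ℤ) * (s m).1.2.1 ≤ N * (M₀ + N * K) :=
    mul_le_mul_of_nonneg_left (by linarith) (by positivity)
  have h4 : (0 : ℤ) ≤ (s m).1.2.2 := by positivity
  linarith

/-! ### Exclusivity, the energy threshold and the threshold budget -/

theorem not_enforces₂_of_enforces₁ {c : G.Config} {P Q : (ℕ → V) → Prop}
    (hPQ : ∀ π, P π → ¬ Q π) (h₁ : G.Enforces₁ c P) : ¬ G.Enforces₂ c Q :=
  fun ⟨τ, hτ, h₂⟩ =>
    let ⟨σ, hσ, h₁⟩ := h₁
    hPQ _ (h₁ τ hτ) (h₂ σ hσ)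

theorem not_consWins_of_presWins {M : ℤ} {v : V} {B : G.Budget} (h : G.PresWins M v B) :
    ¬ G.ConsWins M v B :=
  G.not_enforces₂_of_enforces₁ (fun _ h ⟨m, hm⟩ => (h m).not_gt hm) h

theorem not_minWins_of_maxWins {v : V} {B : G.Budget} (h : G.MaxWins v B) : ¬ G.MinWins v B :=
  G.not_enforces₂_of_enforces₁ (fun _ => not_lt.2) h

variable {G} in
theorem PresWins.mono {M M' : ℤ} (hM : M ≤ M') {v : V} {B : G.Budget} (h : G.PresWins M v B) :
    G.PresWins M' v B :=
  let ⟨σ, hσ, h⟩ := h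
  ⟨σ, hσ, fun τ hτ m => (h τ hτ m).trans (by gcongr)⟩

theorem presWins_iff_survivesAlways [Finite V] {M : ℤ} {v : V} {B : G.Budget} :
    G.PresWins M v B ↔ G.SurvivesAlways (v, B.1) M :=
  ⟨fun h => not_not.1 fun h' =>
    G.not_consWins_of_presWins h (G.consWins_of_not_survivesAlways h'),
    G.presWins_of_survivesAlways⟩

variable {G} in
-- This determines `energy` through Preserver's winning levels alone, whence uniqueness. It holds
-- because those levels are upward closed and exclude a win of Consumer.
theorem IsEnergyThreshold.le_iff {energy : V → G.Budget → ℕ∞} (h : G.IsEnergyThreshold energy)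
    (v : V) (B : G.Budget) (n : ℕ) : energy v B ≤ n ↔ G.PresWins n v B := by
  obtain ⟨hfin, htop⟩ := h v B
  cases he : energy v B with
  | top => simpa using fun h' => G.not_consWins_of_presWins h' (htop he n)
  | coe M =>
    obtain ⟨hp, hc⟩ := hfin M he
    rw [Nat.cast_le]
    refine ⟨fun hM => hp.mono (by exact_mod_cast hM), fun h' => ?_⟩
    by_contra hlt
    exact G.not_consWins_of_presWins (h'.mono (by omega)) hc

open Classical in
theorem exists_isEnergyThreshold [Finite V] :
    ∃ energy : V → G.Budget → ℕ∞, G.IsEnergyThreshold energy := by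
  refine ⟨fun v B => if h : ∃ M : ℕ, G.PresWins M v B then (Nat.find h : ℕ∞) else ⊤,
    fun v B => ⟨fun M hM => ?_, fun htop M => ?_⟩⟩
  · dsimp only at hM
    split_ifs at hM with h
    · obtain rfl : Nat.find h = M := by exact_mod_cast hM
      refine ⟨Nat.find_spec h, G.consWins_of_not_survivesAlways fun h' => ?_⟩
      -- This excludes a least level of 0, so that its predecessor is a natural number and
      -- contradicts minimality.
      have hnn := SurvivesAlways.nonneg G h'
      refine Nat.find_min h (m := Nat.find h - 1) (by omega) ?_
      rw [presWins_iff_survivesAlways]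
      rwa [Nat.cast_sub (by omega), Nat.cast_one]
    · exact absurd hM.symm (ENat.natCast_ne_top M)
  · dsimp only at htop
    split_ifs at htop with h
    · exact absurd htop (ENat.natCast_ne_top _)
    · exact G.consWins_of_not_survivesAlways fun h' => h ⟨M, G.presWins_of_survivesAlways h'⟩

variable {G} in
theorem IsEnergyThreshold.unique {e e' : V → G.Budget → ℕ∞} (h : G.IsEnergyThreshold e)
    (h' : G.IsEnergyThreshold e') : e' = e := by
  have key : ∀ {e e' : V → G.Budget → ℕ∞}, G.IsEnergyThreshold e → G.IsEnergyThreshold e' →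
      ∀ v B, e' v B ≤ e v B := by
    intro e e' h h' v B
    cases he : e v B with
    | top => exact le_top
    | coe M => exact (h'.le_iff v B M).2 ((h.le_iff v B M).1 he.le)
  exact funext₂ fun v B => le_antisymm (key h h' v B) (key h' h v B)

variable {G} in
theorem IsEnergyThreshold.lt_top_iff [Finite V] {e : V → G.Budget → ℕ∞}
    (h : G.IsEnergyThreshold e) (v : V) (B : G.Budget) :
    e v B < ⊤ ↔ ∃ M, G.SurvivesAlways (v, B.1) M := by
  constructor
  · intro hlt
    lift e v B to ℕ using hlt.ne with M hM
    exact ⟨M, G.presWins_iff_survivesAlways.1 ((h.le_iff v B M).1 hM.ge)⟩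
  · rintro ⟨M, hM⟩
    obtain ⟨n, rfl⟩ := Int.eq_ofNat_of_zero_le (SurvivesAlways.nonneg G hM)
    exact ((h.le_iff v B n).2 (G.presWins_of_survivesAlways hM)).trans_lt (ENat.natCast_lt_top n)

variable {G} in
theorem IsEnergyThreshold.lt_top_mono [Finite V] {e : V → G.Budget → ℕ∞}
    (h : G.IsEnergyThreshold e) {v : V} {B B' : G.Budget} (hB : B ≤ B') (hlt : e v B < ⊤) :
    e v B' < ⊤ := by
  rw [h.lt_top_iff] at hlt ⊢
  obtain ⟨M, hM⟩ := hlt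
  exact ⟨M, fun n => (hM n).mono_budget hB B'.2⟩

variable {G} in
theorem IsEnergyThreshold.thresholdBudget_le_iff [Finite V] {e : V → G.Budget → ℕ∞}
    (h : G.IsEnergyThreshold e) (v : V) (B : G.Budget) :
    G.thresholdBudget e v ≤ B.1 ↔ e v B < ⊤ := by
  rw [thresholdBudget]
  split_ifs with hne
  · refine ⟨fun hle => h.lt_top_mono hle (WellFounded.min_mem _ _ hne), fun hlt => ?_⟩
    exact not_lt.1 (WellFounded.not_lt_min (wellFounded_lt (α := G.Budget)) _ hlt)
  · refine ⟨fun hle => ?_, fun hlt => absurd ⟨B, hlt⟩ hne⟩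
    have hB := B.2
    rw [le_iff_pos] at hle hB
    rw [pos_total] at hB
    -- The default value `k + 1` lies just above the total budget `k*`, which has position `2 * k +
    -- 1`.
    have : (⟨G.k + 1, false⟩ : StarNat).pos = 2 * (G.k + 1) := rfl
    omega

end BiddingGame

theorem mainTheorem6 {V : Type*} [Finite V] (G : BiddingGame V) :
    ∃ energy : V → G.Budget → ℕ∞,
      G.IsEnergyThreshold energy ∧
      (∀ energy' : V → G.Budget → ℕ∞, G.IsEnergyThreshold energy' → energy' = energy) ∧
      (∀ (v : V) (B : G.Budget),
        (energy v B < ⊤ ↔ G.MaxWins v B) ∧ (energy v B = ⊤ ↔ G.MinWins v B)) ∧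
      (∀ (v : V) (B : G.Budget),
        (G.thresholdBudget energy v ≤ B.1 ↔ G.MaxWins v B) ∧
        (B.1 < G.thresholdBudget energy v ↔ G.MinWins v B)) := by
  obtain ⟨e, he⟩ := G.exists_isEnergyThreshold
  have hmax : ∀ v B, e v B < ⊤ → G.MaxWins v B := fun v B hlt =>
    let ⟨_, hM⟩ := (he.lt_top_iff v B).1 hlt
    G.maxWins_of_presWins (G.presWins_of_survivesAlways hM)
  have hmin : ∀ v B, ¬ e v B < ⊤ → G.MinWins v B := fun v B hlt => by
    rw [he.lt_top_iff, not_exists] at hlt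
    exact G.minWins_of_not_survivesAlways hlt
  have hmax' : ∀ v B, e v B < ⊤ ↔ G.MaxWins v B := fun v B =>
    ⟨hmax v B, fun h => not_not.1 fun h' => G.not_minWins_of_maxWins h (hmin v B h')⟩
  have hmin' : ∀ v B, ¬ e v B < ⊤ ↔ G.MinWins v B := fun v B =>
    ⟨hmin v B, fun h h' => G.not_minWins_of_maxWins (hmax v B h') h⟩
  refine ⟨e, he, fun e' he' => he.unique he', fun v B => ⟨hmax' v B, ?_⟩, fun v B => ⟨?_, ?_⟩⟩
  · rw [← hmin', not_lt_top_iff]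
  · rw [he.thresholdBudget_le_iff, hmax']
  · rw [← not_le, he.thresholdBudget_le_iff, hmin']
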